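/- \textbf{Existence of distributionally robust mixed equilibria in finite games.} Let $(\Omega,\mathcal F,m)$ be a probability space, let $f:\mathbb R\to(-\infty,+\infty]$ be a proper convex function with $f(1)<+\infty$ (a function given only on $[0,\infty)$ is extended by $+\infty$), and let $\rho>0$. For a probability measure $\tilde m\ll m$ put $$D_f(\tilde m\,\|\,m)=\int_\Omega f\Big(\frac{d\tilde m}{dm}\Big)\,dm-f(1),$$ and let $B_\rho(m)$ be the set of probability measures $\tilde m\ll m$ with $D_f(\tilde m\,\|\,m)\le\rho$. Let $\mathcal J$ be a finite set of players. Each player $j\in\mathcal J$ has a non-empty finite set $\mathcal A_j$ of actions and a loss function $l_j:\prod_{k\in\mathcal J}\mathcal A_k\times\Omega\to\mathbb R$. Assume that the robust payoffs (losses) $$R_j(a)=\sup_{\tilde m\in B_\rho(m)}\mathbb E_{\tilde m}\,l_j(a,\omega),\qquad a\in\prod_{k}\mathcal A_k,\ j\in\mathcal J,$$ are well defined and finite, that is, $l_j(a,\cdot)$ is integrable with respect to every $\tilde m\in B_\rho(m)$ and the supremum is finite. Let $\mathcal X_j$ be the simplex of probability vectors (mixed strategies) on $\mathcal A_j$, and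 for $x\in\prod_k\mathcal X_k$ let $$\overline R_j(x)=\sum_{a\in\prod_k\mathcal A_k}\Big(\prod_{k\in\mathcal J}x_k(a_k)\Big)R_j(a)$$ be the expected robust payoff of player $j$ (the mixed extension of the game). Then there is a distributionally robust mixed equilibrium: a profile $x^*\in\prod_k\mathcal X_k$ such that $$\overline R_j(x^*)\le\overline R_j(x_j,x^*_{-j})\qquad\text{for every } j\in\mathcal J \text{ and every } x_j\in\mathcal X_j .$$ -/

import Mathlib

open MeasureTheory

namespace RobustGame

noncomputable section

/-- A proper convex function `ℝ → (-∞, +∞]` whose value at `1` is finite. A function that is given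
on `[0, ∞)` or `(0, ∞)` only is extended by `+∞`. Convexity is convexity of the epigraph. -/
structure IsDivergenceGenerator (f : ℝ → EReal) : Prop where
  convex_epigraph : Convex ℝ {p : ℝ × ℝ | f p.1 ≤ (p.2 : EReal)}
  ne_bot : ∀ x, f x ≠ ⊥
  one_ne_top : f 1 ≠ ⊤

/-- The integral of an extended-real function, positive part minus negative part. -/
def extIntegral {Ω : Type*} [MeasurableSpace Ω] (m : Measure Ω) (g : Ω → EReal) : EReal :=
  ((∫⁻ ω, (g ω).toENNReal ∂m : ENNReal) : EReal)
    - ((∫⁻ ω, (-(g ω)).toENNReal ∂m : ENNReal) : EReal)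

/-- The `f`-divergence `D_f(μ ‖ m) = ∫ f(dμ/dm) dm - f(1)`, for `μ ≪ m`. -/
def fDivergence {Ω : Type*} [MeasurableSpace Ω] (f : ℝ → EReal) (μ m : Measure Ω) : EReal :=
  extIntegral m (fun ω => f (μ.rnDeriv m ω).toReal) - f 1

/-- The uncertainty set `B_ρ(m)`: the probability measures `μ ≪ m` with `D_f(μ ‖ m) ≤ ρ`. -/
def uncertaintySet {Ω : Type*} [MeasurableSpace Ω] (f : ℝ → EReal) (m : Measure Ω) (ρ : ℝ) :
    Set (Measure Ω) :=
  {μ | IsProbabilityMeasure μ ∧ μ ≪ m ∧ fDivergence f μ m ≤ (ρ : EReal)}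

/-- The expected values of `l` under the distributions in `B_ρ(m)`. -/
def expectedValues {Ω : Type*} [MeasurableSpace Ω] (f : ℝ → EReal) (m : Measure Ω) (ρ : ℝ)
    (l : Ω → ℝ) : Set ℝ :=
  (fun μ : Measure Ω => ∫ ω, l ω ∂μ) '' uncertaintySet f m ρ

/-- The robust payoff (a loss) `sup_{μ ∈ B_ρ(m)} E_μ[l]`. -/
def robustLoss {Ω : Type*} [MeasurableSpace Ω] (f : ℝ → EReal) (m : Measure Ω) (ρ : ℝ)
    (l : Ω → ℝ) : ℝ :=
  sSup (expectedValues f m ρ l)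

/-- A profile of mixed strategies: one point of the simplex over `A j` for each player `j`. -/
def IsMixedProfile {ι : Type*} {A : ι → Type*} [∀ j, Fintype (A j)] (x : ∀ j, A j → ℝ) : Prop :=
  ∀ j, x j ∈ stdSimplex ℝ (A j)

/-- The expectation of `R : (∏ j, A j) → ℝ` when the players draw their actions independently,
player `k` from the mixed strategy `x k`. -/
def mixedExtension {ι : Type*} [Fintype ι] [DecidableEq ι] {A : ι → Type*} [∀ j, Fintype (A j)]
    (R : (∀ j, A j) → ℝ) (x : ∀ j, A j → ℝ) : ℝ :=
  ∑ a : (∀ j, A j), (∏ k, x k (a k)) * R a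

/-- `x` is an equilibrium of the mixed extension of the distributionally robust game with state
law `m`, generator `f`, radius `ρ` and losses `l j a ω`: no player can decrease her expected robust
loss by changing her own mixed strategy. -/
def IsRobustMixedEquilibrium {Ω : Type*} [MeasurableSpace Ω] {ι : Type*} [Fintype ι]
    [DecidableEq ι] {A : ι → Type*} [∀ j, Fintype (A j)] (f : ℝ → EReal) (m : Measure Ω) (ρ : ℝ)
    (l : ι → (∀ j, A j) → Ω → ℝ) (x : ∀ j, A j → ℝ) : Prop :=
  IsMixedProfile x ∧
    ∀ j, ∀ y ∈ stdSimplex ℝ (A j),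
      mixedExtension (fun a => robustLoss f m ρ (l j a)) x ≤
        mixedExtension (fun a => robustLoss f m ρ (l j a)) (Function.update x j y)

end

end RobustGame

namespace Scarf

open Finset

variable {T I : Type*}

/-- `σ` dominates with respect to the orders in `C` if no point lies, for every `i ∈ C`, strictly
above the `i`-minimum of `σ`. -/
def Dominant (u : I → T → ℕ) (σ : Finset T) (C : Finset I) : Prop :=
  ∀ y, ∃ i ∈ C, ∀ x ∈ σ, u i y ≤ u i x

theorem Dominant.mono {u : I → T → ℕ} {σ τ : Finset T} {C D : Finset I} (h : Dominant u σ C)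
    (hτ : τ ⊆ σ) (hC : C ⊆ D) : Dominant u τ D := fun y =>
  let ⟨i, hi, hy⟩ := h y
  ⟨i, hC hi, fun x hx => hy x (hτ hx)⟩

/-- Each point of a dominant set is the minimum for some order, and distinct points for distinct
orders. -/
theorem Dominant.exists_index {u : I → T → ℕ} (hu : ∀ i, Function.Injective (u i))
    {σ : Finset T} {C : Finset I} (h : Dominant u σ C) :
    ∃ g : T → I, (∀ x ∈ σ, g x ∈ C) ∧ (∀ x ∈ σ, ∀ t ∈ σ, u (g x) x ≤ u (g x) t) ∧
      Set.InjOn g σ := by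
  choose g hg hmin using h
  refine ⟨g, fun x _ => hg x, fun x _ => hmin x, fun x hx y hy hxy => hu (g x) ?_⟩
  exact le_antisymm (hmin x y hy) (hxy ▸ hmin y x hx)

theorem Dominant.min_index_unique {u : I → T → ℕ} (hu : ∀ i, Function.Injective (u i))
    {σ : Finset T} {C : Finset I} (h : Dominant u σ C) (hcard : σ.card = C.card)
    {i j : I} (hi : i ∈ C) (hj : j ∈ C) {x : T} (hx : x ∈ σ)
    (hxi : ∀ t ∈ σ, u i x ≤ u i t) (hxj : ∀ t ∈ σ, u j x ≤ u j t) : i = j := by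
  obtain ⟨g, hg, hmin, hinj⟩ := h.exists_index hu
  have hsurj := surjOn_of_injOn_of_card_le g (fun x hx => hg x hx) hinj hcard.ge
  have key : ∀ k ∈ C, (∀ t ∈ σ, u k x ≤ u k t) → k = g x := by
    intro k hk hxk
    obtain ⟨y, hy, rfl⟩ := hsurj hk
    have : x = y := hu (g y) (le_antisymm (hxk y hy) (hmin y hy x hx))
    rw [this]
  rw [key i hi hxi, key j hj hxj]

/-- In a dominant pair with one more order than points, exactly two orders share their minimum. -/
theorem Dominant.exists_pair [DecidableEq I] {u : I → T → ℕ} (hu : ∀ i, Function.Injective (u i))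
    {τ : Finset T} {D : Finset I} (h : Dominant u τ D) (hcard : D.card = τ.card + 1)
    (hne : τ.Nonempty) :
    ∃ i ∈ D, ∃ j ∈ D, i ≠ j ∧
      (∃ p ∈ τ, (∀ t ∈ τ, u i p ≤ u i t) ∧ (∀ t ∈ τ, u j p ≤ u j t)) ∧
      ∀ a ∈ D, ∀ b ∈ D, a ≠ b → ∀ p ∈ τ, (∀ t ∈ τ, u a p ≤ u a t) →
        (∀ t ∈ τ, u b p ≤ u b t) → (a = i ∧ b = j) ∨ (a = j ∧ b = i) := by
  obtain ⟨g, hg, hmin, hinj⟩ := h.exists_index hu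
  have hsub : τ.image g ⊆ D := image_subset_iff.2 hg
  have hc : (D \ τ.image g).card = 1 := by
    rw [card_sdiff_of_subset hsub, card_image_of_injOn hinj]; omega
  obtain ⟨j, hj⟩ := card_eq_one.1 hc
  have hjD : j ∈ D ∧ j ∉ τ.image g := by
    rw [← mem_sdiff, hj]; exact mem_singleton_self j
  have hrest : ∀ a ∈ D, a ≠ j → ∃ y ∈ τ, g y = a := by
    intro a ha haj
    by_contra hcon
    have : a ∈ D \ τ.image g := by
      rw [mem_sdiff, mem_image]; exact ⟨ha, hcon⟩
    rw [hj, mem_singleton] at this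
    exact haj this
  obtain ⟨p, hp, hpmin⟩ := exists_min_image τ (u j) hne
  have key : ∀ a ∈ D, a ≠ j → ∀ q ∈ τ, (∀ t ∈ τ, u a q ≤ u a t) → a = g q := by
    intro a ha haj q hq hqa
    obtain ⟨y, hy, rfl⟩ := hrest a ha haj
    have : q = y := hu (g y) (le_antisymm (hqa y hy) (hmin y hy q hq))
    rw [this]
  have keyj : ∀ q ∈ τ, (∀ t ∈ τ, u j q ≤ u j t) → q = p := fun q hq hqj =>
    hu j (le_antisymm (hqj p hp) (hpmin q hq))
  refine ⟨g p, hg p hp, j, hjD.1, fun e => hjD.2 (mem_image.2 ⟨p, hp, e⟩),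
    ⟨p, hp, hmin p hp, hpmin⟩, ?_⟩
  intro a ha b hb hab q hq hqa hqb
  by_cases haj : a = j
  · subst haj
    refine Or.inr ⟨rfl, ?_⟩
    rw [key b hb (Ne.symm hab) q hq hqb, keyj q hq hqa]
  · by_cases hbj : b = j
    · subst hbj
      refine Or.inl ⟨?_, rfl⟩
      rw [key a ha haj q hq hqa, keyj q hq hqb]
    · exact absurd ((key a ha haj q hq hqa).trans (key b hb hbj q hq hqb).symm) hab

variable [DecidableEq I]

/-- The points of a door all of whose colours but `i₀` are present. -/
def IsColoredDoor (c : T → I) (i₀ : I) (τ : Finset T) : Prop :=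
  Set.InjOn c τ ∧ i₀ ∉ τ.image c

theorem IsColoredDoor.card {c : T → I} {i₀ : I} {τ : Finset T} (h : IsColoredDoor c i₀ τ) :
    (insert i₀ (τ.image c)).card = τ.card + 1 := by
  rw [card_insert_of_notMem h.2, card_image_of_injOn h.1]

variable [DecidableEq T]

/-- The room `r` is obtained from the door `(τ, D)` by dropping the order `k`, or by adding a new
point which is the `k`-minimum. -/
def RoomAt (u : I → T → ℕ) (τ : Finset T) (D : Finset I) (k : I) (r : Finset T × Finset I) : Prop :=
  (r.1 = τ ∧ r.2 = D.erase k) ∨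
    (r.2 = D ∧ ∃ x, x ∉ τ ∧ r.1 = insert x τ ∧ ∀ t ∈ τ, u k x < u k t)

/-- The room `r` has the door `(τ, D)`. -/
def HasDoor (τ : Finset T) (D : Finset I) (r : Finset T × Finset I) : Prop :=
  (r.1 = τ ∧ ∃ k ∈ D, r.2 = D.erase k) ∨ (r.2 = D ∧ ∃ x, x ∉ τ ∧ r.1 = insert x τ)

theorem HasDoor.card_eq {τ : Finset T} {D : Finset I} {r : Finset T × Finset I}
    (h : HasDoor τ D r) (hcard : D.card = τ.card + 1) : r.1.card = r.2.card := by
  rcases h with ⟨h1, k, hk, h2⟩ | ⟨h2, x, hx, h1⟩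
  · rw [h1, h2, card_erase_of_mem hk]; omega
  · rw [h1, h2, card_insert_of_notMem hx]; omega

theorem HasDoor.dominant {u : I → T → ℕ} {τ : Finset T} {D : Finset I} {r : Finset T × Finset I}
    (h : HasDoor τ D r) (hr : Dominant u r.1 r.2) : Dominant u τ D := by
  rcases h with ⟨h1, k, hk, h2⟩ | ⟨h2, x, hx, h1⟩
  · exact hr.mono h1.ge (h2 ▸ erase_subset _ _)
  · exact hr.mono (h1 ▸ subset_insert _ _) h2.le

theorem RoomAt.hasDoor {u : I → T → ℕ} {τ : Finset T} {D : Finset I} {k : I} (hk : k ∈ D)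
    {r : Finset T × Finset I} (h : RoomAt u τ D k r) : HasDoor τ D r := by
  rcases h with ⟨h1, h2⟩ | ⟨h2, x, hx, h1, -⟩
  · exact Or.inl ⟨h1, k, hk, h2⟩
  · exact Or.inr ⟨h2, x, hx, h1⟩

theorem existsUnique_roomAt [Finite T] {u : I → T → ℕ} (hu : ∀ i, Function.Injective (u i))
    {τ : Finset T} {D : Finset I} (h : Dominant u τ D) (hcard : D.card = τ.card + 1)
    {k k' : I} (hk : k ∈ D) (hk' : k' ∈ D) (hkk : k ≠ k') {p : T} (hp : p ∈ τ)
    (hpk : ∀ t ∈ τ, u k p ≤ u k t) (hpk' : ∀ t ∈ τ, u k' p ≤ u k' t) :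
    ∃! r : Finset T × Finset I, Dominant u r.1 r.2 ∧ RoomAt u τ D k r := by
  have hin : ∀ x, x ∉ τ → (∀ t ∈ τ, u k x < u k t) → Dominant u (insert x τ) D →
      (∀ i ∈ D, i ≠ k → ∃ t ∈ τ, u i t < u i x) ∧
      ∀ y, (∀ i ∈ D, i ≠ k → ∃ t ∈ τ, u i t < u i y) → u k y ≤ u k x := by
    intro x hx hxk hd
    constructor
    · intro i hi hik
      by_contra! hcon
      refine hik (hd.min_index_unique hu (by rw [card_insert_of_notMem hx, hcard]) hi hk
        (mem_insert_self x τ) ?_ ?_)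
      · intro t ht
        rcases mem_insert.1 ht with rfl | ht
        exacts [le_rfl, hcon t ht]
      · intro t ht
        rcases mem_insert.1 ht with rfl | ht
        exacts [le_rfl, (hxk t ht).le]
    · intro y hy
      obtain ⟨i, hi, hiy⟩ := hd y
      by_cases hik : i = k
      · subst hik; exact hiy x (mem_insert_self x τ)
      · obtain ⟨t, ht, htlt⟩ := hy i hi hik
        exact absurd (hiy t (mem_insert_of_mem ht)) (not_le.2 htlt)
  by_cases hM : ∃ y, ∀ i ∈ D, i ≠ k → ∃ t ∈ τ, u i t < u i y
  · obtain ⟨x, hxM, hxmax⟩ := Set.exists_max_image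
      {y | ∀ i ∈ D, i ≠ k → ∃ t ∈ τ, u i t < u i y} (u k) (Set.toFinite _) hM
    simp only [Set.mem_ofPred_eq] at hxM hxmax
    have hMk : ∀ y, (∀ i ∈ D, i ≠ k → ∃ t ∈ τ, u i t < u i y) → ∀ t ∈ τ, u k y ≤ u k t := by
      intro y hy
      obtain ⟨i, hi, hiy⟩ := h y
      by_cases hik : i = k
      · subst hik; exact hiy
      · obtain ⟨t, ht, htlt⟩ := hy i hi hik
        exact absurd (hiy t ht) (not_le.2 htlt)
    have hxτ : x ∉ τ := by
      intro hx
      have : x = p := hu k (le_antisymm (hMk x hxM p hp) (hpk x hx))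
      obtain ⟨t, ht, htlt⟩ := hxM k' hk' hkk.symm
      exact absurd (hpk' t ht) (not_le.2 (this ▸ htlt))
    refine ⟨(insert x τ, D), ⟨?_, Or.inr ⟨rfl, x, hxτ, rfl, ?_⟩⟩, ?_⟩
    · intro y
      by_cases hy : ∀ i ∈ D, i ≠ k → ∃ t ∈ τ, u i t < u i y
      · refine ⟨k, hk, fun t ht => ?_⟩
        rcases mem_insert.1 ht with rfl | ht
        exacts [hxmax y hy, hMk y hy t ht]
      · push Not at hy
        obtain ⟨i, hi, hik, hy⟩ := hy
        refine ⟨i, hi, fun t ht => ?_⟩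
        rcases mem_insert.1 ht with rfl | ht
        · obtain ⟨s, hs, hlt⟩ := hxM i hi hik
          exact (hy s hs).trans hlt.le
        · exact hy t ht
    · intro t ht
      refine lt_of_le_of_ne (hMk x hxM t ht) fun e => hxτ (hu k e ▸ ht)
    · rintro ⟨σ, C⟩ ⟨hd, ⟨h1, h2⟩ | ⟨h2, z, hz, h1, hzk⟩⟩
      · simp only at h1 h2 hd
        subst h1 h2
        obtain ⟨i, hi, hix⟩ := hd x
        obtain ⟨t, ht, htlt⟩ := hxM i (mem_of_mem_erase hi) (ne_of_mem_erase hi)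
        exact absurd (hix t ht) (not_le.2 htlt)
      · simp only at h1 h2 hd
        subst h1 h2
        obtain ⟨hzM, hzmax⟩ := hin z hz hzk hd
        have : z = x := hu k (le_antisymm (hxmax z hzM) (hzmax x hxM))
        rw [this]
  · refine ⟨(τ, D.erase k), ⟨?_, Or.inl ⟨rfl, rfl⟩⟩, ?_⟩
    · intro y
      push Not at hM
      obtain ⟨i, hi, hik, hy⟩ := hM y
      exact ⟨i, mem_erase.2 ⟨hik, hi⟩, hy⟩
    · rintro ⟨σ, C⟩ ⟨hd, ⟨h1, h2⟩ | ⟨h2, z, hz, h1, hzk⟩⟩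
      · simp only at h1 h2
        rw [h1, h2]
      · simp only at h1 h2 hd
        subst h1 h2
        exact absurd ⟨z, (hin z hz hzk hd).1⟩ hM

/-- A door with a point belongs to exactly two rooms. -/
theorem exists_two_rooms [Finite T] {u : I → T → ℕ} (hu : ∀ i, Function.Injective (u i))
    {τ : Finset T} {D : Finset I} (h : Dominant u τ D) (hcard : D.card = τ.card + 1)
    (hne : τ.Nonempty) :
    ∃ r₁ r₂ : Finset T × Finset I, r₁ ≠ r₂ ∧
      ∀ r, (Dominant u r.1 r.2 ∧ HasDoor τ D r) ↔ r = r₁ ∨ r = r₂ := by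
  obtain ⟨i, hi, j, hj, hij, ⟨p, hp, hpi, hpj⟩, huniq⟩ := h.exists_pair hu hcard hne
  obtain ⟨r₁, ⟨hd₁, hr₁⟩, hu₁⟩ := existsUnique_roomAt hu h hcard hi hj hij hp hpi hpj
  obtain ⟨r₂, ⟨hd₂, hr₂⟩, hu₂⟩ := existsUnique_roomAt hu h hcard hj hi hij.symm hp hpj hpi
  refine ⟨r₁, r₂, ?_, ?_⟩
  · rintro rfl
    rcases hr₁ with ⟨h1, h2⟩ | ⟨h2, x, hx, h1, hxi⟩
    · rcases hr₂ with ⟨h1', h2'⟩ | ⟨h2', -⟩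
      · exact notMem_erase i D (by rw [← h2, h2']; exact mem_erase.2 ⟨hij, hi⟩)
      · exact notMem_erase i D (by rw [← h2, h2']; exact hi)
    · rcases hr₂ with ⟨h1', h2'⟩ | ⟨h2', y, hy, h1', hyj⟩
      · exact notMem_erase j D (by rw [← h2', h2]; exact hj)
      · have hxy : x = y := by
          have : x ∈ insert y τ := by rw [← h1', h1]; exact mem_insert_self x τ
          exact (mem_insert.1 this).resolve_right hx
        subst hxy
        rw [h1, h2] at hd₁
        refine hij (hd₁.min_index_unique hu (by rw [card_insert_of_notMem hx, hcard]) hi hj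
          (mem_insert_self x τ) ?_ ?_)
        · intro t ht
          rcases mem_insert.1 ht with rfl | ht
          exacts [le_rfl, (hxi t ht).le]
        · intro t ht
          rcases mem_insert.1 ht with rfl | ht
          exacts [le_rfl, (hyj t ht).le]
  · intro r
    constructor
    · rintro ⟨hd, hr⟩
      have hcr := hr.card_eq hcard
      suffices hh : RoomAt u τ D i r ∨ RoomAt u τ D j r from
        hh.imp (fun hh => hu₁ r ⟨hd, hh⟩) (fun hh => hu₂ r ⟨hd, hh⟩)
      rcases hr with ⟨h1, k, hk, h2⟩ | ⟨h2, x, hx, h1⟩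
      · by_cases hki : k = i
        · subst hki; exact Or.inl (Or.inl ⟨h1, h2⟩)
        by_cases hkj : k = j
        · subst hkj; exact Or.inr (Or.inl ⟨h1, h2⟩)
        rw [h1, h2] at hd hcr
        exact absurd (hd.min_index_unique hu hcr (mem_erase.2 ⟨Ne.symm hki, hi⟩)
          (mem_erase.2 ⟨Ne.symm hkj, hj⟩) hp hpi hpj) hij
      · rw [h1, h2] at hd
        obtain ⟨k, hk, hkx⟩ := hd x
        have hlt : ∀ t ∈ τ, u k x < u k t := fun t ht =>
          lt_of_le_of_ne (hkx t (mem_insert_of_mem ht)) fun e => hx (hu k e ▸ ht)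
        obtain ⟨q, hq, hqmin⟩ := exists_min_image τ (u k) hne
        obtain ⟨a, ha, haq⟩ := hd q
        have hka : k ≠ a := by
          rintro rfl
          exact absurd (haq x (mem_insert_self x τ)) (not_le.2 (hlt q hq))
        rcases huniq k hk a ha hka q hq hqmin (fun t ht => haq t (mem_insert_of_mem ht)) with
          ⟨rfl, -⟩ | ⟨rfl, -⟩
        · exact Or.inl (Or.inr ⟨h2, x, hx, h1, hlt⟩)
        · exact Or.inr (Or.inr ⟨h2, x, hx, h1, hlt⟩)
    · rintro (rfl | rfl)
      exacts [⟨hd₁, hr₁.hasDoor hi⟩, ⟨hd₂, hr₂.hasDoor hj⟩]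

/-- The door `(∅, {i})` belongs to exactly one room. -/
theorem exists_one_room [Finite T] [Nonempty T] {u : I → T → ℕ}
    (hu : ∀ i, Function.Injective (u i)) (i : I) :
    ∃ r₁ : Finset T × Finset I, ∀ r, (Dominant u r.1 r.2 ∧ HasDoor ∅ {i} r) ↔ r = r₁ := by
  obtain ⟨x, -, hx⟩ := Set.exists_max_image (Set.univ : Set T) (u i) (Set.toFinite _)
    Set.univ_nonempty
  refine ⟨({x}, {i}), fun r => ⟨?_, ?_⟩⟩
  · rintro ⟨hd, ⟨h1, k, hk, h2⟩ | ⟨h2, y, -, h1⟩⟩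
    · rw [mem_singleton.1 hk, erase_singleton] at h2
      obtain ⟨j, hj, -⟩ := hd x
      rw [h2] at hj
      exact absurd hj (notMem_empty j)
    · obtain ⟨j, hj, hjy⟩ := hd x
      rw [h2, mem_singleton] at hj
      subst hj
      have : y = x := hu j (le_antisymm (hx y trivial) (hjy y (by simp [h1])))
      rw [Prod.ext_iff, h1, h2, this]
      exact ⟨rfl, rfl⟩
  · rintro rfl
    refine ⟨fun y => ⟨i, mem_singleton_self i, fun z hz => ?_⟩, Or.inr ⟨rfl, x, by simp, by simp⟩⟩
    rw [mem_singleton.1 hz]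
    exact hx y trivial

/-- A room which is not fully coloured has no coloured door, or exactly two. -/
theorem coloredDoors_none_or_two (c : T → I) (i₀ : I) {r : Finset T × Finset I}
    (hcard : r.1.card = r.2.card) (hcol : r.1.image c ≠ r.2) :
    (∀ τ, ¬(IsColoredDoor c i₀ τ ∧ HasDoor τ (insert i₀ (τ.image c)) r)) ∨
      ∃ τ₁ τ₂, τ₁ ≠ τ₂ ∧
        ∀ τ, (IsColoredDoor c i₀ τ ∧ HasDoor τ (insert i₀ (τ.image c)) r) ↔ τ = τ₁ ∨ τ = τ₂ := by
  obtain ⟨σ, C⟩ := r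
  simp only at hcard hcol
  by_cases hinj : Set.InjOn c σ
  · by_cases hi₀ : i₀ ∈ σ.image c
    · left
      rintro τ ⟨⟨hτ, hiτ⟩, ⟨h1, -⟩ | ⟨h2, x, hx, h1⟩⟩
      · simp only at h1; subst h1; exact hiτ hi₀
      · simp only at h1 h2
        subst h1
        rw [image_insert, mem_insert] at hi₀
        apply hcol
        rw [image_insert, h2, ← hi₀.resolve_right hiτ]
    · by_cases hex : ∃ x ∈ σ, C = (insert i₀ (σ.image c)).erase (c x)
      · right
        obtain ⟨x, hx, hC⟩ := hex
        have himg : (σ.erase x).image c = (σ.image c).erase (c x) := by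
          ext a
          simp only [mem_image, mem_erase]
          constructor
          · rintro ⟨y, ⟨hyx, hy⟩, rfl⟩
            exact ⟨fun e => hyx (hinj hy hx e), y, hy, rfl⟩
          · rintro ⟨ha, y, hy, rfl⟩
            exact ⟨y, ⟨fun e => ha (e ▸ rfl), hy⟩, rfl⟩
        have hne : i₀ ≠ c x := fun e => hi₀ (e ▸ mem_image_of_mem c hx)
        refine ⟨σ, σ.erase x, fun e => notMem_erase x σ (e ▸ hx), fun τ => ⟨?_, ?_⟩⟩
        · rintro ⟨⟨hτ, hiτ⟩, ⟨h1, -⟩ | ⟨h2, y, hy, h1⟩⟩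
          · exact Or.inl h1.symm
          · right
            simp only at h1 h2
            have hcx : c x ∉ insert i₀ (τ.image c) := by
              rw [← h2, hC]; exact notMem_erase _ _
            have hxy : x = y := by
              rw [h1, mem_insert] at hx
              refine hx.resolve_right fun hxτ => hcx ?_
              exact mem_insert_of_mem (mem_image_of_mem c hxτ)
            rw [h1, hxy, erase_insert hy]
        · rintro (rfl | rfl)
          · exact ⟨⟨hinj, hi₀⟩, Or.inl ⟨rfl, c x,
              mem_insert_of_mem (mem_image_of_mem c hx), hC⟩⟩
          · refine ⟨⟨hinj.mono (by simp), fun hh => hi₀ ?_⟩, Or.inr ⟨?_, x, notMem_erase x σ, ?_⟩⟩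
            · exact image_subset_image (erase_subset x σ) hh
            · simp only
              rw [hC, himg, erase_insert_of_ne hne]
            · exact (insert_erase hx).symm
      · left
        rintro τ ⟨⟨hτ, hiτ⟩, ⟨h1, k, hk, h2⟩ | ⟨h2, y, hy, h1⟩⟩
        · simp only at h1 h2
          subst h1
          rcases mem_insert.1 hk with rfl | hk
          · rw [erase_insert hi₀] at h2
            exact hcol h2.symm
          · obtain ⟨x, hx, rfl⟩ := mem_image.1 hk
            exact hex ⟨x, hx, h2⟩
        · simp only at h1 h2
          subst h1
          refine hex ⟨y, mem_insert_self y τ, ?_⟩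
          have hyτ : c y ∉ τ.image c := by
            intro hh
            obtain ⟨z, hz, hzy⟩ := mem_image.1 hh
            have : z = y := hinj (by simp [hz]) (by simp) hzy
            exact hy (this ▸ hz)
          have hne : c y ≠ i₀ := by
            rintro rfl
            exact hi₀ (by simp)
          rw [h2, image_insert, Finset.insert_comm, erase_insert]
          simp only [mem_insert, not_or]
          exact ⟨hne, hyτ⟩
  · simp only [Set.InjOn, not_forall] at hinj
    obtain ⟨x, hx, y, hy, hxy, hne⟩ := hinj
    rw [mem_coe] at hx hy
    have himx : ∀ z ∈ σ, ∀ w ∈ σ, c z = c w → z ≠ w → (σ.erase z).image c = σ.image c := by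
      intro z hz w hw hzw hn
      refine (image_subset_image (erase_subset _ _)).antisymm fun a ha => ?_
      obtain ⟨v, hv, rfl⟩ := mem_image.1 ha
      by_cases hvz : v = z
      · exact mem_image.2 ⟨w, mem_erase.2 ⟨hn.symm, hw⟩, by rw [hvz, hzw]⟩
      · exact mem_image_of_mem c (mem_erase.2 ⟨hvz, hv⟩)
    have hmain : ∀ τ, (IsColoredDoor c i₀ τ ∧ HasDoor τ (insert i₀ (τ.image c)) (σ, C)) →
        (τ = σ.erase x ∨ τ = σ.erase y) := by
      rintro τ ⟨⟨hτ, hiτ⟩, ⟨h1, -⟩ | ⟨h2, z, hz, h1⟩⟩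
      · simp only at h1
        subst h1
        exact absurd (hτ hx hy hxy) hne
      · simp only at h1
        by_cases hzx : x = z
        · left; rw [h1, hzx, erase_insert hz]
        by_cases hzy : y = z
        · right; rw [h1, hzy, erase_insert hz]
        rw [h1] at hx hy
        exact absurd (hτ ((mem_insert.1 hx).resolve_left hzx)
          ((mem_insert.1 hy).resolve_left hzy) hxy) hne
    have hconv : i₀ ∉ σ.image c → C = insert i₀ (σ.image c) → ∀ z ∈ σ, ∀ w ∈ σ, c z = c w → z ≠ w →
        (IsColoredDoor c i₀ (σ.erase z) ∧
          HasDoor (σ.erase z) (insert i₀ ((σ.erase z).image c)) (σ, C)) := by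
      intro hi hC z hz w hw hzw hn
      have him := himx z hz w hw hzw hn
      refine ⟨⟨?_, him ▸ hi⟩, Or.inr ⟨him ▸ hC, z, notMem_erase z σ, (insert_erase hz).symm⟩⟩
      apply card_image_iff.1
      rw [him, card_erase_of_mem hz, hcard, hC, card_insert_of_notMem hi]
      rfl
    by_cases hC : i₀ ∉ σ.image c ∧ C = insert i₀ (σ.image c)
    · right
      refine ⟨σ.erase x, σ.erase y, fun e => ?_, fun τ => ⟨hmain τ, ?_⟩⟩
      · exact notMem_erase x σ (e ▸ mem_erase.2 ⟨hne, hx⟩)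
      · rintro (rfl | rfl)
        · exact hconv hC.1 hC.2 x hx y hy hxy hne
        · exact hconv hC.1 hC.2 y hy x hx hxy.symm (Ne.symm hne)
    · left
      intro τ hτ
      apply hC
      have him : τ.image c = σ.image c := by
        rcases hmain τ hτ with rfl | rfl
        · exact himx x hx y hy hxy hne
        · exact himx y hy x hx hxy.symm (Ne.symm hne)
      have hm := hmain τ hτ
      obtain ⟨⟨-, hi⟩, ⟨h1, -⟩ | ⟨h2, -⟩⟩ := hτ
      · simp only at h1
        rcases hm with h | h
        · exact absurd hx (by rw [h1, h]; exact notMem_erase x σ)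
        · exact absurd hy (by rw [h1, h]; exact notMem_erase y σ)
      · exact ⟨him ▸ hi, him ▸ h2⟩

/-- Scarf's lemma: every colouring of the points by the orders has a fully coloured dominant set. -/
theorem exists_colorful [Fintype T] [Nonempty T] [Fintype I] [Nonempty I] {u : I → T → ℕ}
    (hu : ∀ i, Function.Injective (u i)) (c : T → I) :
    ∃ σ : Finset T, Dominant u σ (σ.image c) := by
  classical
  by_contra! hno
  obtain ⟨i₀⟩ := ‹Nonempty I›
  let rooms : Finset (Finset T × Finset I) :=
    univ.filter fun r => r.1.card = r.2.card ∧ Dominant u r.1 r.2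
  let doors : Finset (Finset T) := univ.filter (IsColoredDoor c i₀)
  let R : Finset T → Finset T × Finset I → Prop := fun τ r => HasDoor τ (insert i₀ (τ.image c)) r
  have hcount := sum_card_bipartiteAbove_eq_sum_card_bipartiteBelow (s := doors) (t := rooms) R
  have hroom : ∀ r ∈ rooms, Even (doors.bipartiteBelow R r).card := by
    intro r hr
    obtain ⟨-, hc, hd⟩ := mem_filter.1 hr
    rcases coloredDoors_none_or_two c i₀ hc (fun e => hno r.1 (e ▸ hd)) with h | ⟨τ₁, τ₂, hne, h⟩
    · have : doors.bipartiteBelow R r = ∅ := by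
        ext τ
        simpa [bipartiteBelow, doors, R] using h τ
      rw [this]; simp
    · have : doors.bipartiteBelow R r = {τ₁, τ₂} := by
        ext τ
        simpa [bipartiteBelow, doors, R] using h τ
      rw [this, card_pair hne]; exact even_two
  have habove : ∀ τ ∈ doors, ∀ r, r ∈ rooms.bipartiteAbove R τ ↔
      (Dominant u r.1 r.2 ∧ HasDoor τ (insert i₀ (τ.image c)) r) := by
    intro τ hτ r
    have hτ' := (mem_filter.1 hτ).2
    simp only [bipartiteAbove, rooms, R, mem_filter, mem_univ, true_and]
    exact ⟨fun h => ⟨h.1.2, h.2⟩, fun h => ⟨⟨h.2.card_eq hτ'.card, h.1⟩, h.2⟩⟩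
  have hdoor : ∀ τ ∈ doors.erase ∅, Even (rooms.bipartiteAbove R τ).card := by
    intro τ hτ
    obtain ⟨hne, hτ⟩ := mem_erase.1 hτ
    by_cases hd : Dominant u τ (insert i₀ (τ.image c))
    · obtain ⟨r₁, r₂, hr, h⟩ := exists_two_rooms hu hd (mem_filter.1 hτ).2.card
        (nonempty_iff_ne_empty.2 hne)
      have : rooms.bipartiteAbove R τ = {r₁, r₂} := by
        ext r
        rw [habove τ hτ, h, mem_insert, mem_singleton]
      rw [this, card_pair hr]; exact even_two
    · have : rooms.bipartiteAbove R τ = ∅ := by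
        ext r
        rw [habove τ hτ]
        simpa using fun hdr hdo => hd (HasDoor.dominant hdo hdr)
      rw [this]; simp
  have hempty : (∅ : Finset T) ∈ doors := by simp [doors, IsColoredDoor]
  have hone : (rooms.bipartiteAbove R ∅).card = 1 := by
    obtain ⟨r₁, h⟩ := exists_one_room hu i₀
    refine card_eq_one.2 ⟨r₁, ?_⟩
    ext r
    rw [habove ∅ hempty, mem_singleton, ← h]
    rfl
  rw [← add_sum_erase _ _ hempty, hone] at hcount
  have h1 : Even (∑ τ ∈ doors.erase ∅, (rooms.bipartiteAbove R τ).card) := even_sum _ hdoor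
  have h2 : Even (∑ r ∈ rooms, (doors.bipartiteBelow R r).card) := even_sum _ hroom
  rw [← hcount, Nat.even_add] at h2
  exact absurd (h2.2 h1) (by decide)

end Scarf

namespace Scarf

open Finset

variable {I : Type*} [Fintype I] [DecidableEq I]

/-- The points of the simplex over `I` with coordinates in `(1 / N) ℤ`, scaled by `N`. -/
abbrev Grid (I : Type*) [Fintype I] (N : ℕ) : Type _ :=
  {x : I → Fin (N + 1) // ∑ i, (x i : ℕ) = N}

/-- The order of the grid points by their `i`-th coordinate, with ties broken by an enumeration. -/
noncomputable def gridOrder (N : ℕ) (i : I) (x : Grid I N) : ℕ :=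
  (x.1 i : ℕ) * Fintype.card (Grid I N) + Fintype.equivFin (Grid I N) x

theorem gridOrder_injective (N : ℕ) (i : I) : Function.Injective (gridOrder N i) := by
  intro x y h
  have h' := congrArg (· % Fintype.card (Grid I N)) h
  simp only [gridOrder, Nat.mul_add_mod_self_right,
    Nat.mod_eq_of_lt (Fintype.equivFin (Grid I N) _).2] at h'
  exact (Fintype.equivFin (Grid I N)).injective (Fin.ext h')

theorem coord_le_of_gridOrder_le {N : ℕ} {i : I} {x y : Grid I N}
    (h : gridOrder N i x ≤ gridOrder N i y) : (x.1 i : ℕ) ≤ y.1 i := by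
  by_contra! hlt
  have h1 := (Fintype.equivFin (Grid I N) y).2
  have h2 : ((y.1 i : ℕ) + 1) * Fintype.card (Grid I N) ≤ (x.1 i : ℕ) * Fintype.card (Grid I N) :=
    Nat.mul_le_mul_right _ hlt
  simp only [gridOrder] at h
  rw [add_one_mul] at h2
  omega

/-- A vector of naturals with sum at most `N` lies below some grid point. -/
theorem exists_grid_ge {N : ℕ} (b : I → ℕ) (i : I) (hb : ∑ j, b j ≤ N) :
    ∃ y : Grid I N, ∀ j, b j ≤ (y.1 j : ℕ) := by
  have hsum : ∑ j, (b j + (Pi.single i (N - ∑ j, b j) : I → ℕ) j) = N := by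
    simp only [sum_add_distrib, Finset.sum_pi_single', mem_univ, if_true]
    omega
  have hle : ∀ j, (b j + (Pi.single i (N - ∑ j, b j) : I → ℕ) j) < N + 1 := fun j =>
    Nat.lt_succ_of_le ((single_le_sum (fun _ _ => Nat.zero_le _) (mem_univ j)).trans hsum.le)
  exact ⟨⟨fun j => ⟨_, hle j⟩, hsum⟩, fun j => Nat.le_add_right _ _⟩

/-- For each colouring of the grid there is a small fully coloured cell. -/
theorem exists_small_colorful_cell [Nonempty I] (N : ℕ) (c : Grid I N → I) :
    ∃ z : Grid I N, ∀ i, (z.1 i : ℕ) ≤ Fintype.card I ∨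
      ∃ w : Grid I N, c w = i ∧ ∀ j, (w.1 j : ℕ) ≤ z.1 j + Fintype.card I ∧
        (z.1 j : ℕ) ≤ w.1 j + Fintype.card I := by
  obtain ⟨i₁⟩ := ‹Nonempty I›
  obtain ⟨y₀, -⟩ := exists_grid_ge (N := N) (fun _ : I => 0) i₁ (by simp)
  have : Nonempty (Grid I N) := ⟨y₀⟩
  have : Nonempty I := ⟨i₁⟩
  obtain ⟨σ, hσ⟩ := exists_colorful (gridOrder_injective (I := I) N) c
  have hne : σ.Nonempty := by
    obtain ⟨i, hi, -⟩ := hσ y₀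
    exact image_nonempty.1 ⟨i, hi⟩
  let μ : I → ℕ := fun i => σ.inf' hne fun x => (x.1 i : ℕ)
  have hμ : ∀ x ∈ σ, ∀ i, μ i ≤ x.1 i := fun x hx i => inf'_le (fun x : Grid I N => (x.1 i : ℕ)) hx
  have hbig : N < ∑ i ∈ σ.image c, (μ i + 1) := by
    by_contra! hle
    obtain ⟨y, hy⟩ := exists_grid_ge (N := N) (fun i => if i ∈ σ.image c then μ i + 1 else 0) i₁
      (by rwa [sum_ite_mem, univ_inter])
    obtain ⟨i, hi, hiy⟩ := hσ y
    have h1 := hy i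
    simp only [if_pos hi] at h1
    have h2 : (y.1 i : ℕ) ≤ μ i := le_inf' _ _ fun x hx => coord_le_of_gridOrder_le (hiy x hx)
    omega
  have hsmall : ∀ x ∈ σ, ∑ i ∈ σ.image c, ((x.1 i : ℕ) - μ i) + ∑ i ∈ (σ.image c)ᶜ, (x.1 i : ℕ)
      ≤ Fintype.card I := by
    intro x hx
    have h1 : ∑ i ∈ σ.image c, (x.1 i : ℕ) + ∑ i ∈ (σ.image c)ᶜ, (x.1 i : ℕ) = N := by
      rw [sum_add_sum_compl]; exact x.2
    have h2 : ∑ i ∈ σ.image c, (x.1 i : ℕ) =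
        ∑ i ∈ σ.image c, ((x.1 i : ℕ) - μ i) + ∑ i ∈ σ.image c, μ i := by
      rw [← sum_add_distrib]
      exact sum_congr rfl fun i _ => (Nat.sub_add_cancel (hμ x hx i)).symm
    have h3 : (σ.image c).card ≤ Fintype.card I := card_le_univ _
    rw [sum_add_distrib, sum_const, smul_eq_mul, mul_one] at hbig
    omega
  have hin : ∀ x ∈ σ, ∀ i ∈ σ.image c, (x.1 i : ℕ) ≤ μ i + Fintype.card I := by
    intro x hx i hi
    have h1 := hsmall x hx
    have h2 : (x.1 i : ℕ) - μ i ≤ ∑ i ∈ σ.image c, ((x.1 i : ℕ) - μ i) :=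
      single_le_sum (f := fun i => (x.1 i : ℕ) - μ i) (fun _ _ => Nat.zero_le _) hi
    omega
  have hout : ∀ x ∈ σ, ∀ i ∉ σ.image c, (x.1 i : ℕ) ≤ Fintype.card I := by
    intro x hx i hi
    have h1 := hsmall x hx
    have h2 : (x.1 i : ℕ) ≤ ∑ i ∈ (σ.image c)ᶜ, (x.1 i : ℕ) :=
      single_le_sum (f := fun i => (x.1 i : ℕ)) (fun _ _ => Nat.zero_le _) (mem_compl.2 hi)
    omega
  have hclose : ∀ x ∈ σ, ∀ w ∈ σ, ∀ j, (w.1 j : ℕ) ≤ x.1 j + Fintype.card I := by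
    intro x hx w hw j
    by_cases hj : j ∈ σ.image c
    · have h1 := hin w hw j hj
      have h2 := hμ x hx j
      omega
    · have := hout w hw j hj
      omega
  obtain ⟨z, hz⟩ := hne
  refine ⟨z, fun i => ?_⟩
  by_cases hi : i ∈ σ.image c
  · obtain ⟨w, hw, rfl⟩ := mem_image.1 hi
    exact Or.inr ⟨w, rfl, fun j => ⟨hclose z hz w hw j, hclose w hw z hz j⟩⟩
  · exact Or.inl (hout z hz i hi)

/-- Approximate form of Brouwer's theorem on the simplex. -/
theorem exists_approx_fixedPoint [Nonempty I] {F : (I → ℝ) → I → ℝ}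
    (hF : Set.MapsTo F (stdSimplex ℝ I) (stdSimplex ℝ I)) (N : ℕ) :
    ∃ z ∈ stdSimplex ℝ I, ∀ i, ∃ w ∈ stdSimplex ℝ I,
      dist w z ≤ Fintype.card I / ((N : ℝ) + 1) ∧ w i ≤ F w i + Fintype.card I / ((N : ℝ) + 1) := by
  have hN : (0 : ℝ) < (N : ℝ) + 1 := by positivity
  let q : Grid I (N + 1) → I → ℝ := fun x i => ((x.1 i : ℕ) : ℝ) / ((N : ℝ) + 1)
  have hq : ∀ x, q x ∈ stdSimplex ℝ I := by
    refine fun x => ⟨fun i => by positivity, ?_⟩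
    simp only [q]
    rw [← sum_div, ← Nat.cast_sum, x.2, Nat.cast_add_one, div_self hN.ne']
  have hcol : ∀ x, ∃ i, q x i ≤ F (q x) i := by
    intro x
    obtain ⟨i, -, hi⟩ := exists_le_of_sum_le (s := (univ : Finset I)) univ_nonempty
      (((hq x).2.trans (hF (hq x)).2.symm).le)
    exact ⟨i, hi⟩
  choose c hc using hcol
  obtain ⟨z, hz⟩ := exists_small_colorful_cell (N + 1) c
  refine ⟨q z, hq z, fun i => ?_⟩
  rcases hz i with h | ⟨w, rfl, hw⟩
  · refine ⟨q z, hq z, by rw [dist_self]; positivity, ?_⟩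
    have h1 : q z i ≤ Fintype.card I / ((N : ℝ) + 1) :=
      div_le_div_of_nonneg_right (by exact_mod_cast h) hN.le
    linarith [(hF (hq z)).1 i]
  · refine ⟨q w, hq w, (dist_pi_le_iff (by positivity)).2 fun j => ?_, ?_⟩
    · rw [Real.dist_eq, ← sub_div, abs_div, abs_of_pos hN]
      refine div_le_div_of_nonneg_right (abs_le.2 ⟨?_, ?_⟩) hN.le
      · have : ((z.1 j : ℕ) : ℝ) ≤ (w.1 j : ℕ) + Fintype.card I := by exact_mod_cast (hw j).2
        linarith
      · have : ((w.1 j : ℕ) : ℝ) ≤ (z.1 j : ℕ) + Fintype.card I := by exact_mod_cast (hw j).1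
        linarith
    · have h0 : (0 : ℝ) ≤ Fintype.card I / ((N : ℝ) + 1) := by positivity
      linarith [hc w]

open Filter Topology in
/-- Brouwer's fixed point theorem on the standard simplex. -/
theorem exists_fixedPoint_stdSimplex [Nonempty I] {F : (I → ℝ) → I → ℝ}
    (hF : Set.MapsTo F (stdSimplex ℝ I) (stdSimplex ℝ I)) (hcont : ContinuousOn F (stdSimplex ℝ I)) :
    ∃ z ∈ stdSimplex ℝ I, F z = z := by
  choose z hz w hw hwz hwF using exists_approx_fixedPoint hF
  obtain ⟨a, ha, φ, hφ, hlim⟩ := (isCompact_stdSimplex ℝ I).tendsto_subseq hz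
  have hε : Tendsto (fun n : ℕ => (Fintype.card I : ℝ) / ((φ n : ℝ) + 1)) atTop (𝓝 0) := by
    have h := (tendsto_one_div_add_atTop_nhds_zero_nat (𝕜 := ℝ)).const_mul (Fintype.card I : ℝ)
    simp only [mul_zero, mul_one_div] at h
    exact h.comp hφ.tendsto_atTop
  have hle : ∀ i, a i ≤ F a i := by
    intro i
    have hwlim : Tendsto (fun n => w (φ n) i) atTop (𝓝 a) := by
      rw [tendsto_iff_dist_tendsto_zero]
      refine squeeze_zero (fun _ => dist_nonneg)
        (fun n => (dist_triangle _ (z (φ n)) _).trans (add_le_add_left (hwz (φ n) i) _)) ?_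
      simpa using hε.add (tendsto_iff_dist_tendsto_zero.1 hlim)
    have hFlim : Tendsto (fun n => F (w (φ n) i)) atTop (𝓝 (F a)) :=
      (hcont a ha).tendsto.comp
        (tendsto_nhdsWithin_iff.2 ⟨hwlim, Eventually.of_forall fun n => hw (φ n) i⟩)
    have h1 := (continuous_apply i).continuousAt.tendsto.comp hwlim
    have h2 := ((continuous_apply i).continuousAt.tendsto.comp hFlim).add hε
    rw [add_zero] at h2
    exact le_of_tendsto_of_tendsto' h1 h2 fun n => hwF (φ n) i
  refine ⟨a, ha, funext fun i => ?_⟩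
  have := (sum_eq_sum_iff_of_le fun i (_ : i ∈ univ) => hle i).1 (ha.2.trans (hF ha).2.symm)
  exact (this i (mem_univ i)).symm

open Filter Topology in
/-- Brouwer's fixed point theorem on a finite product of standard simplices. -/
theorem exists_fixedPoint_pi_stdSimplex {ι : Type*} [Fintype ι] [DecidableEq ι] {A : ι → Type*}
    [∀ j, Fintype (A j)] [∀ j, Nonempty (A j)] {F : (∀ j, A j → ℝ) → ∀ j, A j → ℝ}
    (hF : ∀ x, (∀ j, x j ∈ stdSimplex ℝ (A j)) → ∀ j, F x j ∈ stdSimplex ℝ (A j))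
    (hcont : Continuous F) : ∃ x, (∀ j, x j ∈ stdSimplex ℝ (A j)) ∧ F x = x := by
  classical
  rcases isEmpty_or_nonempty ι with hι | hι
  · exact ⟨isEmptyElim, isEmptyElim, Subsingleton.elim _ _⟩
  have : Nonempty (Σ j, A j) := ⟨⟨hι.some, Classical.arbitrary _⟩⟩
  have hn : (0 : ℝ) < Fintype.card ι := by exact_mod_cast Fintype.card_pos
  have hA : ∀ j, (0 : ℝ) < Fintype.card (A j) := fun j => by exact_mod_cast Fintype.card_pos
  let s : ((Σ j, A j) → ℝ) → ι → ℝ := fun z j => ∑ a, Fintype.card ι * z ⟨j, a⟩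
  let r : ((Σ j, A j) → ℝ) → ∀ j, A j → ℝ := fun z j a =>
    (Fintype.card ι * z ⟨j, a⟩ + max 0 (1 - s z j) / Fintype.card (A j)) / max 1 (s z j)
  have hpos : ∀ z j, 0 < max 1 (s z j) := fun z j => lt_max_of_lt_left one_pos
  have hr : ∀ z ∈ stdSimplex ℝ (Σ j, A j), ∀ j, r z j ∈ stdSimplex ℝ (A j) := by
    refine fun z hz j => ⟨fun a => ?_, ?_⟩
    · have := hz.1 ⟨j, a⟩
      have := hpos z j
      positivity
    · simp only [r]
      rw [← sum_div, sum_add_distrib, sum_const, card_univ, nsmul_eq_mul,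
        mul_div_cancel₀ _ (hA j).ne', div_eq_one_iff_eq (hpos z j).ne']
      change s z j + _ = _
      rcases le_total (s z j) 1 with h | h
      · rw [max_eq_right (by linarith), max_eq_left h]; ring
      · rw [max_eq_left (by linarith), max_eq_right h]; ring
  have hscont : ∀ j, Continuous fun z => s z j := fun j => by fun_prop
  have hrcont : Continuous r := by
    refine continuous_pi fun j => continuous_pi fun a => Continuous.div ?_ ?_ fun z => (hpos z j).ne'
    · have := hscont j
      fun_prop
    · exact continuous_const.max (hscont j)
  have hH : Set.MapsTo (fun z (p : Σ j, A j) => F (r z) p.1 p.2 / Fintype.card ι)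
      (stdSimplex ℝ (Σ j, A j)) (stdSimplex ℝ (Σ j, A j)) := by
    intro z hz
    have h := hF (r z) (hr z hz)
    refine ⟨fun p => div_nonneg ((h p.1).1 p.2) hn.le, ?_⟩
    rw [← sum_div, Fintype.sum_sigma]
    simp only [(h _).2, sum_const, card_univ, nsmul_eq_mul, mul_one]
    exact div_self hn.ne'
  have hHcont : Continuous (fun z (p : Σ j, A j) => F (r z) p.1 p.2 / Fintype.card ι) := by
    have := hcont.comp hrcont
    refine continuous_pi fun p => Continuous.div_const ?_ _
    exact (continuous_apply p.2).comp ((continuous_apply p.1).comp this)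
  obtain ⟨z, hz, hfix⟩ := exists_fixedPoint_stdSimplex hH hHcont.continuousOn
  have hx := hF (r z) (hr z hz)
  have hval : ∀ j a, Fintype.card ι * z ⟨j, a⟩ = F (r z) j a := by
    intro j a
    rw [← congrFun hfix ⟨j, a⟩]
    exact mul_div_cancel₀ _ hn.ne'
  have hs : ∀ j, s z j = 1 := by
    intro j
    simp only [s, hval, (hx j).2]
  have hrz : r z = F (r z) := by
    funext j a
    change (Fintype.card ι * z ⟨j, a⟩ + max 0 (1 - s z j) / Fintype.card (A j)) / max 1 (s z j) = _
    rw [hs, hval]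
    simp
  exact ⟨r z, hr z hz, hrz.symm⟩

end Scarf

namespace RobustGame

open Finset

variable {ι : Type*} [Fintype ι] [DecidableEq ι] {A : ι → Type*} [∀ j, Fintype (A j)]

theorem continuous_mixedExtension (R : (∀ j, A j) → ℝ) : Continuous (mixedExtension R) := by
  unfold mixedExtension
  fun_prop

/-- The mixed extension is linear in the strategy of each player. -/
theorem mixedExtension_update [∀ j, DecidableEq (A j)] (R : (∀ j, A j) → ℝ) (x : ∀ j, A j → ℝ)
    (j : ι) (y : A j → ℝ) :
    mixedExtension R (Function.update x j y) =
      ∑ b, y b * mixedExtension R (Function.update x j (Pi.single b 1)) := by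
  have hprod : ∀ (w : A j → ℝ) (a : ∀ j, A j), ∏ k, Function.update x j w k (a k) =
      w (a j) * ∏ k ∈ univ.erase j, x k (a k) := by
    intro w a
    rw [← mul_prod_erase univ _ (mem_univ j), Function.update_self]
    congr 1
    refine prod_congr rfl fun k hk => ?_
    rw [Function.update_of_ne (ne_of_mem_erase hk)]
  simp only [mixedExtension, hprod, mul_sum]
  rw [sum_comm]
  refine sum_congr rfl fun a _ => ?_
  rw [sum_eq_single (a j)]
  · simp [mul_assoc]
  · intro b _ hb
    simp [Pi.single_eq_of_ne hb.symm]
  · simp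

/-- Nash's theorem: a finite game has an equilibrium in mixed strategies. -/
theorem exists_nash_equilibrium [∀ j, Nonempty (A j)] (R : ι → (∀ j, A j) → ℝ) :
    ∃ x : ∀ j, A j → ℝ, IsMixedProfile x ∧ ∀ j, ∀ y ∈ stdSimplex ℝ (A j),
      mixedExtension (R j) x ≤ mixedExtension (R j) (Function.update x j y) := by
  classical
  let v : (∀ j, A j → ℝ) → ∀ j, A j → ℝ := fun x j a =>
    mixedExtension (R j) (Function.update x j (Pi.single a 1))
  let g : (∀ j, A j → ℝ) → ∀ j, A j → ℝ := fun x j a => max 0 (mixedExtension (R j) x - v x j a)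
  have hg : ∀ x j a, 0 ≤ g x j a := fun x j a => le_max_left _ _
  have hG : ∀ x j, 0 < 1 + ∑ b, g x j b := fun x j =>
    add_pos_of_pos_of_nonneg one_pos (sum_nonneg fun b _ => hg x j b)
  have hgcont : ∀ j a, Continuous fun x => g x j a := fun j a =>
    continuous_const.max ((continuous_mixedExtension (R j)).sub
      ((continuous_mixedExtension (R j)).comp (continuous_id.update j continuous_const)))
  obtain ⟨x, hx, hfix⟩ := Scarf.exists_fixedPoint_pi_stdSimplex
    (F := fun x j a => (x j a + g x j a) / (1 + ∑ b, g x j b))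
    (fun x hx j => ⟨fun a => div_nonneg (add_nonneg ((hx j).1 a) (hg x j a)) (hG x j).le, by
      rw [← sum_div, sum_add_distrib, (hx j).2, div_self (hG x j).ne']⟩)
    (continuous_pi fun j => continuous_pi fun a => Continuous.div
      (((continuous_apply a).comp (continuous_apply j) :
        Continuous fun x : ∀ j, A j → ℝ => x j a).add (hgcont j a))
      (continuous_const.add (continuous_finsetSum _ fun b _ => hgcont j b))
      fun x => (hG x j).ne')
  have hlin : ∀ j, mixedExtension (R j) x = ∑ a, x j a * v x j a := fun j => by
    rw [← mixedExtension_update, Function.update_eq_self]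
  have hmul : ∀ j a, g x j a = x j a * ∑ b, g x j b := by
    intro j a
    have h := congrFun (congrFun hfix j) a
    rw [div_eq_iff (hG x j).ne'] at h
    linarith
  have hzero : ∀ j a, g x j a * (mixedExtension (R j) x - v x j a) = g x j a ^ 2 := by
    intro j a
    simp only [g]
    rcases le_total 0 (mixedExtension (R j) x - v x j a) with h | h
    · rw [max_eq_right h, sq]
    · rw [max_eq_left h]; ring
  have hle : ∀ j a, mixedExtension (R j) x ≤ v x j a := by
    intro j a
    have hsum : ∑ a, g x j a ^ 2 = 0 := by
      calc ∑ a, g x j a ^ 2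
          = ∑ a, (∑ b, g x j b) *
              (x j a * mixedExtension (R j) x - x j a * v x j a) := by
            refine sum_congr rfl fun a _ => ?_
            rw [← hzero, hmul j a]; ring
        _ = 0 := by
            rw [← mul_sum, sum_sub_distrib, ← sum_mul, (hx j).2, ← hlin, one_mul, sub_self,
              mul_zero]
    have h0 := (sum_eq_zero_iff_of_nonneg fun a _ => sq_nonneg (g x j a)).1 hsum a (mem_univ a)
    have h1 : mixedExtension (R j) x - v x j a ≤ g x j a := le_max_right _ _
    rw [pow_eq_zero_iff two_ne_zero] at h0
    linarith
  refine ⟨x, hx, fun j y hy => ?_⟩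
  rw [mixedExtension_update]
  calc mixedExtension (R j) x = ∑ b, y b * mixedExtension (R j) x := by
        rw [← sum_mul, hy.2, one_mul]
    _ ≤ _ := sum_le_sum fun b _ => mul_le_mul_of_nonneg_left (hle j b) (hy.1 b)

end RobustGame

theorem mainTheorem6 {Ω : Type*} [MeasurableSpace Ω] (m : Measure Ω) [IsProbabilityMeasure m]
    (f : ℝ → EReal) (hf : RobustGame.IsDivergenceGenerator f) (ρ : ℝ) (hρ : 0 < ρ)
    {ι : Type*} [Fintype ι] [DecidableEq ι]
    {A : ι → Type*} [∀ j, Fintype (A j)] [∀ j, Nonempty (A j)]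
    (l : ι → (∀ j, A j) → Ω → ℝ)
    (hint : ∀ j a, ∀ μ ∈ RobustGame.uncertaintySet f m ρ, Integrable (l j a) μ)
    (hfin : ∀ j a, BddAbove (RobustGame.expectedValues f m ρ (l j a))) :
    ∃ x : ∀ j, A j → ℝ, RobustGame.IsRobustMixedEquilibrium f m ρ l x := by
  exact RobustGame.exists_nash_equilibrium fun j a => RobustGame.robustLoss f m ρ (l j a)
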